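/- All graphs are finite and simple, and $\log$ denotes the logarithm to base $2$. A clique covering of a graph $G=(V,E)$ is a family $\mathcal C$ of cliques of $G$ such that the two ends of every edge of $G$ lie together in some member of $\mathcal C$; the valency of $\mathcal C$ is the maximum over $x\in V$ of the number of members of $\mathcal C$ that contain $x$. The local clique cover number $\mathrm{lcc}(G)$ is the minimum valency of a clique covering of $G$. A graph $G$ is a linear interval graph if its vertices can be identified with distinct points of the real line and a collection of intervals $[a,b]$ with $a<b$ can be chosen so that two distinct vertices are adjacent if and only if some chosen interval contains both of them. Two adjacent vertices $x,y$ are twins if $N(x)\setminus\{y\}=N(y)\setminus\{x\}$, where $N(x)$ is the set of neighbours of $x$; a graph is twin-free if it has no twins. **Theorem.** There is an absolute constant $c$ such that every linear interval graph $G$ with maximum degree $\Delta\ge 2$ satisfies $$\mathrm{lcc}(G)\le \log\Delta+\tfrac12\log\log\Delta+c,$$ and if $G$ is moreover twin-free, then also $$\mathrm{lcc}(G)\ge \tfrac12\log\Delta+\tfrac14\log\log\Delta-c .$$ -/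

import Mathlib

namespace LocalCliqueCover

variable {V : Type*}

/-- A finite family `𝒞` of vertex sets is a clique covering of `G` if all its members are cliques
of `G` and both ends of every edge of `G` lie in a common member. -/
structure IsCliqueCovering (G : SimpleGraph V) (𝒞 : Finset (Finset V)) : Prop where
  isClique : ∀ C ∈ 𝒞, G.IsClique (C : Set V)
  covers : ∀ x y : V, G.Adj x y → ∃ C ∈ 𝒞, x ∈ C ∧ y ∈ C

/-- The valency of the vertex `x` with respect to `𝒞`: the number of members containing `x`. -/
def vertexValency [DecidableEq V] (𝒞 : Finset (Finset V)) (x : V) : ℕ :=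
  (𝒞.filter (fun C => x ∈ C)).card

/-- The valency of `𝒞`: the maximum of the valencies of the vertices (`0` without vertices). -/
def valency [Fintype V] [DecidableEq V] (𝒞 : Finset (Finset V)) : ℕ :=
  Finset.univ.sup (vertexValency 𝒞)

/-- The local clique cover number `lcc G`: the minimum valency of a clique covering of `G`. -/
noncomputable def lcc [Fintype V] [DecidableEq V] (G : SimpleGraph V) : ℕ :=
  sInf {k : ℕ | ∃ 𝒞 : Finset (Finset V), IsCliqueCovering G 𝒞 ∧ valency 𝒞 = k}

/-- The infimum defining `lcc G` is over a nonempty set, hence it is attained. -/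
theorem exists_covering_valency_eq_lcc [Fintype V] [DecidableEq V] (G : SimpleGraph V) :
    ∃ 𝒞 : Finset (Finset V), IsCliqueCovering G 𝒞 ∧ valency 𝒞 = lcc G := by
  classical
  refine Nat.sInf_mem (s := {k : ℕ | ∃ 𝒞 : Finset (Finset V), IsCliqueCovering G 𝒞 ∧
    valency 𝒞 = k}) ⟨_, Finset.univ.filter (fun C : Finset V => G.IsClique (C : Set V)),
      ⟨?_, ?_⟩, rfl⟩
  · intro C hC
    exact (Finset.mem_filter.1 hC).2
  · intro x y h
    refine ⟨{x, y}, ?_, by simp, by simp⟩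
    rw [Finset.mem_filter]
    refine ⟨Finset.mem_univ _, ?_⟩
    rw [Finset.coe_pair, SimpleGraph.isClique_pair]
    exact fun _ => h

/-- `G` is a linear interval graph: its vertices can be placed at distinct points of the real line,
and a set of intervals `[a, b]` with `a < b` (given by their pairs of end points) can be chosen,
such that two distinct vertices are adjacent if and only if some chosen interval contains both. -/
def IsLinearInterval (G : SimpleGraph V) : Prop :=
  ∃ (p : V → ℝ) (I : Set (ℝ × ℝ)), Function.Injective p ∧ (∀ J ∈ I, J.1 < J.2) ∧
    ∀ x y : V, G.Adj x y ↔
      x ≠ y ∧ ∃ J ∈ I, p x ∈ Set.Icc J.1 J.2 ∧ p y ∈ Set.Icc J.1 J.2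

/-- Twins are adjacent vertices `x`, `y` with `N(x) \ {y} = N(y) \ {x}`. -/
def AreTwins (G : SimpleGraph V) (x y : V) : Prop :=
  G.Adj x y ∧ G.neighborSet x \ {y} = G.neighborSet y \ {x}

/-- A graph is twin-free if it has no twins. -/
def TwinFree (G : SimpleGraph V) : Prop :=
  ∀ x y : V, ¬ AreTwins G x y

end LocalCliqueCover

namespace LocalCliqueCover

/-! Only the umbrella property of the line order is used. For the upper bound, cut the order into
consecutive cliques so that edges stay within a block or join adjacent blocks. Between adjacent
blocks adjacency is a half graph, and Pascal's rule splits a half graph on `(2k).choose k` levels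
into bicliques, each level lying in at most `k` on either side. A biclique between two cliques is a
clique, so valency `2k + 1` suffices once `(2k).choose k` exceeds the maximum degree.

For the lower bound, the upper neighbours of a vertex form a convex clique, whose members have
nested upper neighbourhoods outside it. The cliques through the members and through witnesses of
growth form a skew set-pair system, so Bollobás bounds the number of distinct neighbourhoods.
Without twins this bounds the degree by a multiple of `(2k).choose k`, where `k` is the valency.
Since this is of order `4 ^ k / √k`, taking logarithms gives both bounds. -/

/-! ### Skew set pairs -/

open Finset Polynomial in
/-- The skew version of Bollobás's set-pair inequality. -/
theorem card_le_choose_of_skew_set_pairs {α : Type*} [Fintype α] {n a b : ℕ}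
    (A B : Fin n → Finset α) (hA : ∀ i, (A i).card ≤ a) (hB : ∀ i, (B i).card ≤ b)
    (hdisj : ∀ i, Disjoint (A i) (B i)) (hmeet : ∀ i j, i < j → ¬ Disjoint (A j) (B i)) :
    n ≤ (a + b).choose a := by
  classical
  -- The shift by 1 keeps 0 from being a root of any `P i`, so 0 can pad the lists `w j` to length
  -- `b`.
  let t : α → ℚ := fun v => ((Fintype.equivFin α v : ℕ) : ℚ) + 1
  have ht : Function.Injective t := by
    intro v w h
    have h' : ((Fintype.equivFin α v : ℕ) : ℚ) = ((Fintype.equivFin α w : ℕ) : ℚ) := by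
      simpa [t] using h
    exact (Fintype.equivFin α).injective (Fin.ext (by exact_mod_cast h'))
  have ht0 : ∀ v, t v ≠ 0 := fun v => by positivity
  let P : Fin n → ℚ[X] := fun i => ∏ v ∈ A i, (X - C (t v))
  have hPdeg : ∀ i, (P i).natDegree < a + 1 := fun i => by
    have : (P i).natDegree = (A i).card := natDegree_finsetProd_X_sub_C_eq_card _ _
    have := hA i
    omega
  have hPeval : ∀ i s, (P i).eval s = ∏ v ∈ A i, (s - t v) := fun i s => by
    simp [P, eval_prod]
  let w : Fin n → Fin b → ℚ := fun j l =>
    if h : (l : ℕ) < (B j).card then t ((B j).equivFin.symm ⟨l, h⟩) else 0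
  have hw₁ : ∀ j, ∀ v ∈ B j, ∃ l, w j l = t v := by
    intro j v hv
    have hlt := ((B j).equivFin ⟨v, hv⟩).isLt
    refine ⟨⟨(B j).equivFin ⟨v, hv⟩, hlt.trans_le (hB j)⟩, ?_⟩
    simp [w]
  have hw₂ : ∀ j l, w j l = 0 ∨ ∃ v ∈ B j, w j l = t v := by
    intro j l
    by_cases h : (l : ℕ) < (B j).card
    · exact Or.inr ⟨_, ((B j).equivFin.symm ⟨l, h⟩).2, by simp [w, h]⟩
    · exact Or.inl (by simp [w, h])
  let M : Matrix (Fin n) (Fin n) ℚ := fun i j => ∏ l, (P i).eval (w j l)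
  have htri : M.BlockTriangular id := by
    intro j i hij
    obtain ⟨v, hvA, hvB⟩ := Finset.not_disjoint_iff.1 (hmeet i j hij)
    obtain ⟨l, hl⟩ := hw₁ i v hvB
    refine Finset.prod_eq_zero (mem_univ l) ?_
    rw [hPeval, hl]
    exact Finset.prod_eq_zero hvA (sub_self _)
  have hdiag : ∀ i, M i i ≠ 0 := by
    intro i
    refine Finset.prod_ne_zero_iff.2 fun l _ => ?_
    rw [hPeval]
    refine Finset.prod_ne_zero_iff.2 fun v hv => sub_ne_zero.2 ?_
    rcases hw₂ i l with h | ⟨u, hu, h⟩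
    · rw [h]; exact (ht0 v).symm
    · rw [h]
      intro huv
      exact Finset.disjoint_left.1 (hdisj i) hv (ht huv ▸ hu)
  have hrank : M.rank = n := by
    have hdet : IsUnit M.det := by
      rw [isUnit_iff_ne_zero, Matrix.det_of_isUpperTriangular htri]
      exact Finset.prod_ne_zero_iff.2 fun i _ => hdiag i
    simpa using Matrix.rank_of_isUnit M ((Matrix.isUnit_iff_isUnit_det M).2 hdet)
  -- In the expanded product the coefficients of `P i` depend only on the multiset of exponents, so
  -- `M` factors through multisets of size `b` from `a + 1` symbols.
  let σ : (Fin b → Fin (a + 1)) → Sym (Fin (a + 1)) b := fun φ =>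
    ⟨univ.val.map φ, by simp⟩
  let Y : Matrix (Fin n) (Sym (Fin (a + 1)) b) ℚ := fun i s =>
    (s.1.map fun e : Fin (a + 1) => (P i).coeff (e : ℕ)).prod
  let W : Matrix (Sym (Fin (a + 1)) b) (Fin n) ℚ := fun s j =>
    ∑ φ with σ φ = s, ∏ l, w j l ^ (φ l : ℕ)
  have hfac : M = Y * W := by
    ext i j
    have h₁ : M i j = ∑ φ : Fin b → Fin (a + 1),
        ∏ l, (P i).coeff (φ l) * w j l ^ (φ l : ℕ) := by
      have : ∀ l, (P i).eval (w j l) =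
          ∑ e : Fin (a + 1), (P i).coeff e * w j l ^ (e : ℕ) := fun l => by
        rw [eval_eq_sum_range' (hPdeg i), Finset.sum_range]
      simp only [M, this]
      rw [Finset.prod_univ_sum, Fintype.piFinset_univ]
    rw [h₁, Matrix.mul_apply, ← Finset.sum_fiberwise_of_maps_to
      (s := univ) (t := univ) (g := σ) (fun _ _ => mem_univ _)]
    refine Finset.sum_congr rfl fun s _ => ?_
    simp only [W, Finset.mul_sum]
    refine Finset.sum_congr rfl fun φ hφ => ?_
    obtain rfl := (Finset.mem_filter.1 hφ).2
    rw [Finset.prod_mul_distrib]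
    congr 1
    simp [Y, σ, Finset.prod, Function.comp_def]
  have := (Matrix.rank_mul_le_left Y W).trans (Matrix.rank_le_card_width Y)
  rw [← hfac, hrank, Sym.card_sym_eq_choose, Fintype.card_fin] at this
  rwa [show a + 1 + b - 1 = a + b by omega, ← Nat.choose_symm_add] at this

/-! ### Half graphs -/

open Finset in
/-- Splitting a half graph on `(a + b).choose a` levels into complete bipartite pieces: the triple
`(l, m, r)` stands for the piece with upper levels `[m, r)` and lower levels `[l, m)`. -/
theorem exists_halfGraph_cover (a b : ℕ) : ∀ lo : ℕ, ∃ T : Finset (ℕ × ℕ × ℕ),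
    (∀ g f, lo ≤ g → g < f → f < lo + (a + b).choose a →
      ∃ t ∈ T, t.1 ≤ g ∧ g < t.2.1 ∧ t.2.1 ≤ f ∧ f < t.2.2) ∧
    (∀ u, (T.filter fun t => t.2.1 ≤ u ∧ u < t.2.2).card ≤ a) ∧
    (∀ u, (T.filter fun t => t.1 ≤ u ∧ u < t.2.1).card ≤ b) ∧
    ∀ t ∈ T, lo ≤ t.1 ∧ t.1 ≤ t.2.1 ∧ t.2.1 ≤ t.2.2 ∧ t.2.2 ≤ lo + (a + b).choose a := by
  induction a generalizing b with
  | zero => exact fun lo => ⟨∅, fun g f _ _ h => by simp at h; omega, by simp, by simp, by simp⟩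
  | succ a iha =>
  induction b with
  | zero => exact fun lo => ⟨∅, fun g f _ _ h => by simp at h; omega, by simp, by simp, by simp⟩
  | succ b ihb =>
  intro lo
  obtain ⟨T₁, cov₁, up₁, low₁, bd₁⟩ := ihb lo
  obtain ⟨T₂, cov₂, up₂, low₂, bd₂⟩ := iha (b + 1) (lo + (a + 1 + b).choose (a + 1))
  have hN : (a + 1 + (b + 1)).choose (a + 1) =
      (a + 1 + b).choose (a + 1) + (a + (b + 1)).choose a := by
    rw [show a + 1 + (b + 1) = (a + 1 + b) + 1 by omega, Nat.choose_succ_succ, add_comm,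
      show a + (b + 1) = a + 1 + b by omega]
  rw [hN]
  generalize (a + 1 + b).choose (a + 1) = N₁ at *
  generalize (a + (b + 1)).choose a = N₂ at *
  -- The new piece takes all pairs across the cut. It costs the left part one lower use and the
  -- right part one upper use, hence the budgets `(a + 1, b)` and `(a, b + 1)`.
  refine ⟨insert (lo, lo + N₁, lo + N₁ + N₂) (T₁ ∪ T₂), ?_, ?_, ?_, ?_⟩
  · intro g f hg hgf hf
    by_cases h₁ : f < lo + N₁
    · obtain ⟨t, ht, h⟩ := cov₁ g f hg hgf h₁
      exact ⟨t, by simp [ht], h⟩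
    by_cases h₂ : lo + N₁ ≤ g
    · obtain ⟨t, ht, h⟩ := cov₂ g f h₂ hgf (by omega)
      exact ⟨t, by simp [ht], h⟩
    · exact ⟨_, mem_insert_self _ _, by dsimp only; omega⟩
  · intro u
    by_cases hu : u < lo + N₁
    · refine le_trans (card_le_card ?_) (up₁ u)
      intro t ht
      simp only [mem_filter, mem_insert, mem_union] at ht ⊢
      obtain ⟨rfl | ht | ht, h⟩ := ht
      · dsimp only at h; omega
      · exact ⟨ht, h⟩
      · have := bd₂ t ht; omega
    · refine le_trans (card_le_card (t := insert (lo, lo + N₁, lo + N₁ + N₂)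
        (T₂.filter fun t => t.2.1 ≤ u ∧ u < t.2.2)) ?_)
        ((card_insert_le _ _).trans (Nat.succ_le_succ (up₂ u)))
      intro t ht
      simp only [mem_filter, mem_insert, mem_union] at ht ⊢
      obtain ⟨rfl | ht | ht, h⟩ := ht
      · exact Or.inl rfl
      · have := bd₁ t ht; omega
      · exact Or.inr ⟨ht, h⟩
  · intro u
    by_cases hu : u < lo + N₁
    · refine le_trans (card_le_card (t := insert (lo, lo + N₁, lo + N₁ + N₂)
        (T₁.filter fun t => t.1 ≤ u ∧ u < t.2.1)) ?_)
        ((card_insert_le _ _).trans (Nat.succ_le_succ (low₁ u)))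
      intro t ht
      simp only [mem_filter, mem_insert, mem_union] at ht ⊢
      obtain ⟨rfl | ht | ht, h⟩ := ht
      · exact Or.inl rfl
      · exact Or.inr ⟨ht, h⟩
      · have := bd₂ t ht; omega
    · refine le_trans (card_le_card ?_) (low₂ u)
      intro t ht
      simp only [mem_filter, mem_insert, mem_union] at ht ⊢
      obtain ⟨rfl | ht | ht, h⟩ := ht
      · dsimp only at h; omega
      · have := bd₁ t ht; omega
      · exact ⟨ht, h⟩
  · intro t ht
    simp only [mem_insert, mem_union] at ht
    obtain rfl | ht | ht := ht
    · dsimp only; omega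
    · have := bd₁ t ht; omega
    · have := bd₂ t ht; omega

/-! ### Central binomial estimates -/

/-- Wallis-type upper bound for the central binomial coefficient. -/
theorem centralBinom_sq_le (k : ℕ) : (2 * k + 1) * k.centralBinom ^ 2 ≤ 16 ^ k := by
  induction k with
  | zero => simp
  | succ k ih =>
    have h := Nat.succ_mul_centralBinom_succ k
    refine Nat.le_of_mul_le_mul_left (c := (k + 1) ^ 2) ?_ (by positivity)
    calc (k + 1) ^ 2 * ((2 * (k + 1) + 1) * (k + 1).centralBinom ^ 2)
        = (2 * k + 3) * ((k + 1) * (k + 1).centralBinom) ^ 2 := by ring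
      _ = 4 * ((2 * k + 3) * (2 * k + 1)) * ((2 * k + 1) * k.centralBinom ^ 2) := by
        rw [h]; ring
      _ ≤ 4 * (4 * (k + 1) ^ 2) * 16 ^ k := by
        refine Nat.mul_le_mul (Nat.mul_le_mul_left _ ?_) ih
        nlinarith
      _ = (k + 1) ^ 2 * 16 ^ (k + 1) := by ring

/-- Wallis-type lower bound for the central binomial coefficient. -/
theorem le_centralBinom_sq {k : ℕ} (hk : 1 ≤ k) : 16 ^ k ≤ 4 * k * k.centralBinom ^ 2 := by
  induction k, hk using Nat.le_induction with
  | base => simp [Nat.centralBinom]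
  | succ k hk ih =>
    have h := Nat.succ_mul_centralBinom_succ k
    refine Nat.le_of_mul_le_mul_left (c := (k + 1) * k) ?_ (by positivity)
    calc (k + 1) * k * 16 ^ (k + 1) = 4 * (4 * (k * (k + 1))) * 16 ^ k := by ring
      _ ≤ 4 * (2 * k + 1) ^ 2 * (4 * k * k.centralBinom ^ 2) := by
        refine Nat.mul_le_mul (Nat.mul_le_mul_left _ ?_) ih
        nlinarith
      _ = k * (4 * (2 * (2 * k + 1) * k.centralBinom) ^ 2) := by ring
      _ = (k + 1) * k * (4 * (k + 1) * (k + 1).centralBinom ^ 2) := by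
        rw [← h]; ring

theorem self_lt_centralBinom (k : ℕ) : k < k.centralBinom := by
  induction k with
  | zero => simp
  | succ k ih =>
    have h := Nat.succ_mul_centralBinom_succ k
    nlinarith

/-- If `D` is at least the central binomial coefficient of `j`, then `2 * j` is at most
`log D + log (log D) / 2`, up to a constant. -/
theorem two_mul_le_of_centralBinom_le {j D : ℕ} (hj : 1 ≤ j) (hD : 2 ≤ D)
    (h : j.centralBinom ≤ D) :
    (2 * j : ℝ) ≤ Real.logb 2 D + 1 / 2 * Real.logb 2 (Real.logb 2 D) + 2 := by
  have hjR : (1 : ℝ) ≤ j := by exact_mod_cast hj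
  have hDR : (2 : ℝ) ≤ D := by exact_mod_cast hD
  have hL : 1 ≤ Real.logb 2 D := by
    rw [Real.le_logb_iff_rpow_le (by norm_num) (by linarith)]; simpa using hDR
  have h16 : ((2 : ℝ) ^ (4 * j)) ≤ 2 ^ 2 * (j * (D : ℝ) ^ 2) := by
    have h₁ : 16 ^ j ≤ 4 * j * D ^ 2 :=
      (le_centralBinom_sq hj).trans (Nat.mul_le_mul_left _ (Nat.pow_le_pow_left h 2))
    have h₂ : ((16 : ℝ) ^ j) ≤ 4 * j * (D : ℝ) ^ 2 := by exact_mod_cast h₁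
    rw [pow_mul]
    norm_num
    linarith
  have h4 := Real.logb_le_logb_of_le (b := 2) (by norm_num) (by positivity) h16
  rw [Real.logb_mul (by positivity) (by positivity), Real.logb_mul (by positivity) (by positivity),
    Real.logb_pow, Real.logb_pow, Real.logb_pow, Real.logb_self_eq_one (by norm_num)] at h4
  push_cast at h4
  -- A crude bound on `log j` gives `j = O(log D)`; feeding this back into `h4` yields the `log log`
  -- term.
  have hlogj : Real.logb 2 j ≤ j := by
    rw [Real.logb_le_iff_le_rpow (by norm_num) (by linarith), Real.rpow_natCast]
    exact_mod_cast Nat.lt_two_pow_self.le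
  have hj2 : (j : ℝ) ≤ 2 * Real.logb 2 D := by linarith
  have h5 := Real.logb_le_logb_of_le (b := 2) (by norm_num) (by positivity) hj2
  rw [Real.logb_mul (by positivity) (by positivity), Real.logb_self_eq_one (by norm_num)] at h5
  linarith

/-- If `D` is at most a multiple of the central binomial coefficient of `k`, then `2 * k` is at
least `log D + log (log D) / 2`, up to a constant. -/
theorem le_two_mul_of_le_centralBinom {k D : ℕ} (hk : 1 ≤ k) (hD : 2 ≤ D)
    (h : D ≤ 8 * k.centralBinom) :
    Real.logb 2 D + 1 / 2 * Real.logb 2 (Real.logb 2 D) - 5 ≤ 2 * k := by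
  have hkR : (1 : ℝ) ≤ k := by exact_mod_cast hk
  have hDR : (2 : ℝ) ≤ D := by exact_mod_cast hD
  have hL : 1 ≤ Real.logb 2 D := by
    rw [Real.le_logb_iff_rpow_le (by norm_num) (by linarith)]; simpa using hDR
  have h16 : k * (D : ℝ) ^ 2 ≤ 2 ^ 6 * 2 ^ (4 * k) := by
    have h₁ : k * D ^ 2 ≤ 64 * 16 ^ k := by
      calc k * D ^ 2 ≤ k * (8 * k.centralBinom) ^ 2 := by gcongr
        _ = 64 * (k * k.centralBinom ^ 2) := by ring
        _ ≤ 64 * ((2 * k + 1) * k.centralBinom ^ 2) := by gcongr; omega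
        _ ≤ 64 * 16 ^ k := by gcongr; exact centralBinom_sq_le k
    have h₂ : (k * (D : ℝ) ^ 2) ≤ 64 * 16 ^ k := by exact_mod_cast h₁
    rw [pow_mul]
    norm_num
    linarith
  have h4 := Real.logb_le_logb_of_le (b := 2) (by norm_num) (by positivity) h16
  rw [Real.logb_mul (by positivity) (by positivity), Real.logb_mul (by positivity) (by positivity),
    Real.logb_pow, Real.logb_pow, Real.logb_pow, Real.logb_self_eq_one (by norm_num)] at h4
  push_cast at h4
  have hlogk : 0 ≤ Real.logb 2 k := Real.logb_nonneg (by norm_num) hkR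
  have hk8 : Real.logb 2 D ≤ 2 ^ 3 * k := by linarith
  have h5 := Real.logb_le_logb_of_le (b := 2) (by norm_num) (by positivity) hk8
  rw [Real.logb_mul (by positivity) (by positivity), Real.logb_pow,
    Real.logb_self_eq_one (by norm_num)] at h5
  push_cast at h5
  linarith

/-! ### Umbrella orders and blocks -/

/-- The vertex order given by `p` has the umbrella property: between the ends of an edge, every
vertex is adjacent to both ends. -/
structure IsUmbrellaOrder {V : Type*} (G : SimpleGraph V) (p : V → ℝ) : Prop where
  injective : Function.Injective p
  adj : ∀ {x y z : V}, p x < p y → p y < p z → G.Adj x z → G.Adj x y ∧ G.Adj y z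

theorem IsLinearInterval.exists_isUmbrellaOrder {V : Type*} {G : SimpleGraph V}
    (h : IsLinearInterval G) : ∃ p, IsUmbrellaOrder G p := by
  obtain ⟨p, I, hp, -, hadj⟩ := h
  refine ⟨p, hp, fun {x y z} hxy hyz hxz => ?_⟩
  obtain ⟨-, J, hJ, hx, hz⟩ := (hadj x z).1 hxz
  have hy : p y ∈ Set.Icc J.1 J.2 := ⟨hx.1.trans hxy.le, hyz.le.trans hz.2⟩
  exact ⟨(hadj x y).2 ⟨fun h => hxy.ne (congrArg p h), J, hJ, hx, hy⟩,
    (hadj y z).2 ⟨fun h => hyz.ne (congrArg p h), J, hJ, hy, hz⟩⟩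

/-- Reversing the line turns lower neighbourhoods into upper ones. -/
theorem IsUmbrellaOrder.neg {V : Type*} {G : SimpleGraph V} {p : V → ℝ}
    (h : IsUmbrellaOrder G p) : IsUmbrellaOrder G (fun x => - p x) where
  injective := fun _ _ hxy => h.injective (neg_injective hxy)
  adj := fun hxy hyz hxz =>
    have := h.adj (neg_lt_neg_iff.1 hyz) (neg_lt_neg_iff.1 hxy) hxz.symm
    ⟨this.2.symm, this.1.symm⟩

/-- The vertices of an umbrella order split into consecutive cliques, such that edges join
vertices of the same or of consecutive cliques. -/
theorem IsUmbrellaOrder.exists_blocks {V : Type*} [Fintype V] {G : SimpleGraph V} {p : V → ℝ}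
    (h : IsUmbrellaOrder G p) : ∃ β : V → ℕ, ∀ x y, p x < p y →
      β x ≤ β y ∧ (β x = β y → G.Adj x y) ∧ (G.Adj x y → β y ≤ β x + 1) := by
  classical
  let R : V → V → Prop := fun z x => p z < p x ∧ ¬ G.Adj z x
  have hwf : WellFounded R := by
    have hp : WellFounded fun z x : V => p z < p x := by
      have : IsTrans V fun z x : V => p z < p x := ⟨fun _ _ _ => lt_trans⟩
      have : Std.Irrefl fun z x : V => p z < p x := ⟨fun _ => lt_irrefl _⟩
      exact Finite.wellFounded_of_trans_of_irrefl _
    exact Subrelation.wf (fun h => h.1) hp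
  -- The rank of `R`: the length of a longest chain of successively nonadjacent vertices ending at
  -- `x`.
  let β : V → ℕ := hwf.fix fun x ih =>
    Finset.univ.sup fun z => if hz : R z x then ih z hz + 1 else 0
  have hβ : ∀ x, β x = Finset.univ.sup fun z => if R z x then β z + 1 else 0 := by
    intro x
    have := hwf.fix_eq (fun x ih =>
      Finset.univ.sup fun z => if hz : R z x then ih z hz + 1 else 0) x
    simpa [β, dite_eq_ite] using this
  have hlt : ∀ {z x}, R z x → β z < β x := by
    intro z x hz
    rw [hβ x]
    have := Finset.le_sup (f := fun z => if R z x then β z + 1 else 0) (Finset.mem_univ z)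
    simpa [hz, Nat.succ_le_iff] using this
  have hle : ∀ {x m}, (∀ z, R z x → β z + 1 ≤ m) → β x ≤ m := by
    intro x m hz
    rw [hβ x]
    refine Finset.sup_le fun z _ => ?_
    split_ifs with hR
    · exact hz z hR
    · exact Nat.zero_le _
  have hmono : ∀ x y, p x < p y → β x ≤ β y := fun x y hxy =>
    hle fun z hz => hlt ⟨hz.1.trans hxy, fun hzy => hz.2 (h.adj hz.1 hxy hzy).1⟩
  refine ⟨β, fun x y hxy => ⟨hmono x y hxy, fun heq => ?_, fun hadj => hle fun z hz => ?_⟩⟩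
  · by_contra hn
    exact (hlt (⟨hxy, hn⟩ : R x y)).ne heq
  · refine Nat.succ_le_succ ?_
    rcases lt_trichotomy (p z) (p x) with hzx | hzx | hxz
    · exact hmono z x hzx
    · rw [h.injective hzx]
    · exact absurd (h.adj hxz hz.1 hadj).2 hz.2

/-! ### The upper bound -/

open Finset in
/-- A graph with an umbrella order whose degrees are below the `k`-th central binomial coefficient
has a clique covering of valency at most `2 * k + 1`. -/
theorem IsUmbrellaOrder.lcc_le {V : Type*} [Fintype V] [DecidableEq V] {G : SimpleGraph V}
    [DecidableRel G.Adj] {p : V → ℝ} (h : IsUmbrellaOrder G p) {k : ℕ}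
    (hk : ∀ x, G.degree x < k.centralBinom) : lcc G ≤ 2 * k + 1 := by
  obtain ⟨β, hβ⟩ := h.exists_blocks
  obtain ⟨T, hcov, hup, hlow, -⟩ := exists_halfGraph_cover k k 0
  -- The neighbours of `x` in the next block form an initial segment of it, of length `f x`; `g y`
  -- is the position of `y` in its own block.
  let f : V → ℕ := fun x => #{z | β z = β x + 1 ∧ G.Adj x z}
  let g : V → ℕ := fun y => #{z | β z = β y ∧ p z < p y}
  have hlt_of : ∀ {x y}, β x < β y → p x < p y := by
    intro x y hxy
    by_contra! hle
    rcases hle.lt_or_eq with hlt | heq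
    · exact absurd (hβ y x hlt).1 (by omega)
    · rw [h.injective heq] at hxy
      exact lt_irrefl _ hxy
  have hsame : ∀ {x y}, β x = β y → x ≠ y → G.Adj x y := by
    intro x y hxy hne
    rcases lt_or_gt_of_ne (h.injective.ne hne) with hlt | hlt
    · exact (hβ x y hlt).2.1 hxy
    · exact ((hβ y x hlt).2.1 hxy.symm).symm
  have hadj : ∀ {x y}, β y = β x + 1 → (G.Adj x y ↔ g y < f x) := by
    intro x y hxy
    constructor
    · intro hA
      refine card_lt_card (ssubset_iff_of_subset ?_ |>.2 ⟨y, by simp [hxy, hA], by simp⟩)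
      intro z hz
      simp only [mem_filter_univ] at hz ⊢
      have hβz : β z = β x + 1 := hz.1.trans hxy
      exact ⟨hβz, (h.adj (hlt_of (by omega)) hz.2 hA).1⟩
    · intro hlt
      by_contra hA
      refine absurd (card_le_card ?_) (not_le.2 hlt)
      intro z hz
      simp only [mem_filter_univ] at hz ⊢
      refine ⟨hz.1.trans hxy.symm, ?_⟩
      by_contra! hle
      rcases hle.lt_or_eq with hyz | heq
      · exact hA (h.adj (hlt_of (by omega)) hyz hz.2).1
      · exact hA (h.injective heq ▸ hz.2)
  have hf : ∀ x, f x < (k + k).choose k := by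
    intro x
    rw [← two_mul, ← Nat.centralBinom_eq_two_mul_choose]
    refine lt_of_le_of_lt (card_le_card ?_) (hk x)
    intro z hz
    simpa using (mem_filter.1 hz).2.2
  let D : ℕ → Finset V := fun i => {x | β x = i}
  let K : ℕ → ℕ × ℕ × ℕ → Finset V := fun i t =>
    {x | β x = i ∧ t.2.1 ≤ f x ∧ f x < t.2.2 ∨ β x = i + 1 ∧ t.1 ≤ g x ∧ g x < t.2.1}
  let n := univ.sup β + 1
  have hn : ∀ x, β x < n := fun x => Nat.lt_succ_of_le (le_sup (f := β) (mem_univ x))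
  let 𝒞 : Finset (Finset V) := (range n).image D ∪ (range n ×ˢ T).image fun q => K q.1 q.2
  have h𝒞 : IsCliqueCovering G 𝒞 := by
    constructor
    · intro C hC x hx y hy hne
      simp only [𝒞, mem_union, mem_image, mem_range, mem_product] at hC
      obtain ⟨i, -, rfl⟩ | ⟨⟨i, t⟩, -, rfl⟩ := hC
      · simp only [D, coe_filter, mem_univ, true_and, Set.mem_ofPred_eq] at hx hy
        exact hsame (hx.trans hy.symm) hne
      · simp only [K, coe_filter, mem_univ, true_and, Set.mem_ofPred_eq] at hx hy
        rcases hx with hx | hx <;> rcases hy with hy | hy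
        · exact hsame (hx.1.trans hy.1.symm) hne
        · exact (hadj (by omega)).2 (by omega)
        · exact ((hadj (by omega)).2 (by omega)).symm
        · exact hsame (hx.1.trans hy.1.symm) hne
    · have key : ∀ x y, p x < p y → G.Adj x y → ∃ C ∈ 𝒞, x ∈ C ∧ y ∈ C := by
        intro x y hxy hA
        obtain ⟨h₁, -, h₂⟩ := hβ x y hxy
        rcases Nat.eq_or_lt_of_le h₁ with heq | hlt
        · refine ⟨D (β x), mem_union_left _ (mem_image_of_mem _ (mem_range.2 (hn x))), ?_⟩
          simp [D, heq]
        · have hs : β y = β x + 1 := le_antisymm (h₂ hA) hlt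
          obtain ⟨t, ht, hT⟩ := hcov (g y) (f x) (Nat.zero_le _) ((hadj hs).1 hA)
            (by simpa using hf x)
          refine ⟨K (β x) t, mem_union_right _ (mem_image.2 ⟨(β x, t),
            mem_product.2 ⟨mem_range.2 (hn x), ht⟩, rfl⟩), ?_⟩
          simp [K, hs, hT]
      intro x y hA
      rcases lt_or_gt_of_ne (h.injective.ne hA.ne) with hlt | hlt
      · exact key x y hlt hA
      · obtain ⟨C, hC, hy, hx⟩ := key y x hlt hA.symm
        exact ⟨C, hC, hx, hy⟩
  refine le_trans (Nat.sInf_le ⟨𝒞, h𝒞, rfl⟩) (Finset.sup_le fun x _ => ?_)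
  -- One block, at most `k` pieces towards the next block and at most `k` towards the previous. If
  -- `β x = 0`, truncated subtraction only enlarges the bounding family.
  calc vertexValency 𝒞 x
      ≤ #(insert (D (β x))
          (({t ∈ T | t.2.1 ≤ f x ∧ f x < t.2.2}.image (K (β x))) ∪
            ({t ∈ T | t.1 ≤ g x ∧ g x < t.2.1}.image (K (β x - 1))))) := by
        refine card_le_card fun C hC => ?_
        obtain ⟨hC, hx⟩ := mem_filter.1 hC
        simp only [𝒞, mem_union, mem_image, mem_range, mem_product] at hC
        obtain ⟨i, -, rfl⟩ | ⟨⟨i, t⟩, ⟨-, ht⟩, rfl⟩ := hC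
        · simp only [D, mem_filter_univ] at hx
          simp [hx]
        · simp only [K, mem_filter_univ] at hx
          refine mem_insert_of_mem (mem_union.2 ?_)
          rcases hx with hx | hx
          · exact Or.inl (mem_image.2 ⟨t, mem_filter.2 ⟨ht, hx.2⟩, by rw [hx.1]⟩)
          · exact Or.inr (mem_image.2 ⟨t, mem_filter.2 ⟨ht, hx.2⟩, by
              rw [hx.1, Nat.add_sub_cancel]⟩)
    _ ≤ (k + k) + 1 := (card_insert_le _ _).trans (Nat.succ_le_succ ((card_union_le _ _).trans
        (Nat.add_le_add (card_image_le.trans (hup _)) (card_image_le.trans (hlow _)))))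
    _ = 2 * k + 1 := by ring

/-! ### The lower bound -/

/-- The neighbours of `y` outside `K` and above `y` in the order given by `p`. -/
noncomputable def upperNbrs {V : Type*} [Fintype V] (G : SimpleGraph V) (p : V → ℝ) (K : Finset V)
    (y : V) : Finset V :=
  open Classical in Finset.univ.filter fun z => z ∉ K ∧ G.Adj y z ∧ p y < p z

/-- A clique that is convex in the order given by `p`. -/
structure IsConvexClique {V : Type*} (G : SimpleGraph V) (p : V → ℝ) (K : Finset V) : Prop where
  isClique : G.IsClique (K : Set V)
  convex : ∀ {x y z}, x ∈ K → z ∈ K → p x < p y → p y < p z → y ∈ K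

section

variable {V : Type*} [Fintype V] {G : SimpleGraph V} {p : V → ℝ} {K : Finset V}

theorem mem_upperNbrs {y z : V} :
    z ∈ upperNbrs G p K y ↔ z ∉ K ∧ G.Adj y z ∧ p y < p z := by
  simp [upperNbrs]

theorem IsConvexClique.neg {V : Type*} {G : SimpleGraph V} {p : V → ℝ} {K : Finset V}
    (hK : IsConvexClique G p K) :
    IsConvexClique G (fun x => - p x) K where
  isClique := hK.isClique
  convex := fun hx hz hxy hyz =>
    hK.convex hz hx (neg_lt_neg_iff.1 hyz) (neg_lt_neg_iff.1 hxy)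

/-- By convexity, a vertex outside `K` and above `x` is also above `y`; the umbrella property then
gives adjacency to `y`. -/
theorem IsConvexClique.upperNbrs_subset (hK : IsConvexClique G p K) (h : IsUmbrellaOrder G p)
    {x y : V} (hx : x ∈ K) (hy : y ∈ K) (hxy : p x ≤ p y) :
    upperNbrs G p K x ⊆ upperNbrs G p K y := by
  intro z hz
  rw [mem_upperNbrs] at hz ⊢
  rcases hxy.lt_or_eq with hlt | heq
  · have hyz : p y < p z := by
      by_contra! hle
      rcases hle.lt_or_eq with hzy | heq
      · exact hz.1 (hK.convex hx hy hz.2.2 hzy)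
      · exact hz.1 (h.injective heq ▸ hy)
    exact ⟨hz.1, (h.adj hlt hyz hz.2.1).2, hyz⟩
  · rwa [← h.injective heq]

open Finset in
/-- In a convex clique, the number of different upper neighbourhoods is bounded in terms of the
valency of a clique covering. -/
theorem IsConvexClique.card_image_upperNbrs_le [DecidableEq V] (hK : IsConvexClique G p K)
    (h : IsUmbrellaOrder G p) {𝒞 : Finset (Finset V)} (h𝒞 : IsCliqueCovering G 𝒞) :
    #(K.image fun y => #(upperNbrs G p K y)) ≤ (valency 𝒞).centralBinom + 1 := by
  set S := K.image fun y => #(upperNbrs G p K y) with hS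
  rcases Nat.eq_zero_or_pos #S with h0 | hpos
  · omega
  obtain ⟨s, hs⟩ : ∃ s, #S = s + 1 := ⟨#S - 1, by omega⟩
  let v : Fin (s + 1) ↪o ℕ := S.orderEmbOfFin hs
  have hv : ∀ i, ∃ y ∈ K, #(upperNbrs G p K y) = v i := fun i =>
    mem_image.1 (S.orderEmbOfFin_mem hs i)
  choose y hyK hyv using hv
  have hlt : ∀ {i j}, i < j → p (y i) < p (y j) := by
    intro i j hij
    by_contra! hle
    have := card_le_card (hK.upperNbrs_subset h (hyK j) (hyK i) hle)
    rw [hyv, hyv] at this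
    exact absurd (v.lt_iff_lt.2 hij) (not_lt.2 this)
  -- Each growth step supplies a `z i` adjacent to every later `y` but not to `y i.castSucc`. There
  -- is one step fewer than there are sizes, hence the `+ 1`.
  have hz : ∀ i : Fin s, ∃ z, z ∈ upperNbrs G p K (y i.succ) ∧
      z ∉ upperNbrs G p K (y i.castSucc) := by
    intro i
    by_contra! hsub
    have := card_le_card hsub
    rw [hyv, hyv] at this
    exact absurd (v.lt_iff_lt.2 (Fin.castSucc_lt_succ (i := i))) (not_lt.2 this)
  choose z hz₁ hz₂ using hz
  have hval : ∀ x, #(𝒞.filter fun C => x ∈ C) ≤ valency 𝒞 := fun x =>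
    le_sup (f := vertexValency 𝒞) (mem_univ x)
  have := card_le_choose_of_skew_set_pairs (a := valency 𝒞) (b := valency 𝒞)
    (fun i : Fin s => 𝒞.filter fun C => y i.castSucc ∈ C) (fun i => 𝒞.filter fun C => z i ∈ C)
    (fun i => hval _) (fun i => hval _) ?_ ?_
  · rw [Nat.centralBinom_eq_two_mul_choose, two_mul, hs]
    omega
  · intro i
    refine disjoint_left.2 fun C hC hC' => hz₂ i ?_
    obtain ⟨hC, hy⟩ := mem_filter.1 hC
    have hz := (mem_filter.1 hC').2
    have hup := mem_upperNbrs.1 (hz₁ i)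
    refine mem_upperNbrs.2 ⟨hup.1, h𝒞.isClique C hC hy hz ?_,
      (hlt Fin.castSucc_lt_succ).trans hup.2.2⟩
    rintro heq
    exact hup.1 (heq ▸ hyK _)
  · intro i j hij
    have hle : p (y i.succ) ≤ p (y j.castSucc) := by
      rcases (Fin.succ_le_castSucc_iff.2 hij).lt_or_eq with hl | he
      · exact (hlt hl).le
      · rw [he]
    have hup := mem_upperNbrs.1 (hK.upperNbrs_subset h (hyK _) (hyK _) hle (hz₁ i))
    obtain ⟨C, hC, h₁, h₂⟩ := h𝒞.covers _ _ hup.2.1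
    exact not_disjoint_iff.2 ⟨C, mem_filter.2 ⟨hC, h₁⟩, mem_filter.2 ⟨hC, h₂⟩⟩

/-- Vertices of a convex clique with the same neighbours outside are twins. -/
theorem IsConvexClique.areTwins (hK : IsConvexClique G p K) (h : IsUmbrellaOrder G p) {x y : V}
    (hx : x ∈ K) (hy : y ∈ K) (hne : x ≠ y) (hup : upperNbrs G p K x = upperNbrs G p K y)
    (hlow : upperNbrs G (fun x => - p x) K x = upperNbrs G (fun x => - p x) K y) :
    AreTwins G x y := by
  have key : ∀ {u z}, z ∉ K → u ∈ K → (G.Adj u z ↔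
      z ∈ upperNbrs G p K u ∨ z ∈ upperNbrs G (fun x => - p x) K u) := by
    intro u z hz hu
    have hzu : p u ≠ p z := h.injective.ne fun h => hz (h ▸ hu)
    simp only [mem_upperNbrs, neg_lt_neg_iff]
    rcases lt_or_gt_of_ne hzu with hl | hl <;> simp +contextual [hz, hl]
  refine ⟨hK.isClique hx hy hne, Set.ext fun z => ?_⟩
  simp only [Set.mem_sdiff, SimpleGraph.mem_neighborSet, Set.mem_singleton_iff]
  by_cases hz : z ∈ K
  · refine ⟨fun hA => ⟨hK.isClique hy hz (Ne.symm hA.2), hA.1.ne'⟩,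
      fun hA => ⟨hK.isClique hx hz (Ne.symm hA.2), hA.1.ne'⟩⟩
  · have hzx : z ≠ x := fun h => hz (h ▸ hx)
    have hzy : z ≠ y := fun h => hz (h ▸ hy)
    simp only [hzx, hzy, not_false_eq_true, and_true]
    rw [key hz hx, key hz hy, hup, hlow]

-- Going up in `K`, upper neighbourhoods grow and lower ones shrink; without twins one of them
-- changes strictly, so the counter `φ` of passed sizes is injective.
open Finset in
theorem IsConvexClique.card_le (hK : IsConvexClique G p K) (h : IsUmbrellaOrder G p)
    (hG : TwinFree G) :
    #K ≤ #(K.image fun y => #(upperNbrs G p K y)) +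
      #(K.image fun y => #(upperNbrs G (fun x => - p x) K y)) := by
  classical
  set S := K.image fun y => #(upperNbrs G p K y) with hS
  set S' := K.image fun y => #(upperNbrs G (fun x => - p x) K y) with hS'
  let φ : V → ℕ := fun y => #{v ∈ S | v < #(upperNbrs G p K y)} +
    #{v ∈ S' | #(upperNbrs G (fun x => - p x) K y) < v}
  have hφ : ∀ x ∈ K, ∀ y ∈ K, p x < p y → φ x < φ y := by
    intro x hx y hy hxy
    have h₁ := hK.upperNbrs_subset h hx hy hxy.le
    have h₂ := hK.neg.upperNbrs_subset h.neg hy hx (neg_le_neg hxy.le)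
    have hmono₁ : {v ∈ S | v < #(upperNbrs G p K x)} ⊆ {v ∈ S | v < #(upperNbrs G p K y)} :=
      monotone_filter_right _ fun v _ hv => lt_of_lt_of_le hv (card_le_card h₁)
    have hmono₂ : {v ∈ S' | #(upperNbrs G (fun x => - p x) K x) < v} ⊆
        {v ∈ S' | #(upperNbrs G (fun x => - p x) K y) < v} :=
      monotone_filter_right _ fun v _ hv => lt_of_le_of_lt (card_le_card h₂) hv
    by_cases he : upperNbrs G p K x = upperNbrs G p K y
    · have hne : upperNbrs G (fun x => - p x) K y ≠ upperNbrs G (fun x => - p x) K x :=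
        fun he' => hG x y (hK.areTwins h hx hy (fun e => hxy.ne (congrArg p e)) he he'.symm)
      have hlt := card_lt_card (h₂.ssubset_of_ne hne)
      refine Nat.add_lt_add_of_le_of_lt (card_le_card hmono₁) (card_lt_card
        ((ssubset_iff_of_subset hmono₂).2 ⟨#(upperNbrs G (fun x => - p x) K x), ?_, by simp⟩))
      exact mem_filter.2 ⟨mem_image_of_mem (fun y => #(upperNbrs G (fun x => - p x) K y)) hx, hlt⟩
    · have hlt := card_lt_card (h₁.ssubset_of_ne he)
      refine Nat.add_lt_add_of_lt_of_le (card_lt_card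
        ((ssubset_iff_of_subset hmono₁).2 ⟨#(upperNbrs G p K x), ?_, by simp⟩))
        (card_le_card hmono₂)
      exact mem_filter.2 ⟨mem_image_of_mem (fun y => #(upperNbrs G p K y)) hx, hlt⟩
  rw [← card_range (#S + #S')]
  refine card_le_card_of_injOn φ (fun y hy => ?_) fun x hx y hy hxy => ?_
  · rw [coe_range, Set.mem_Iio]
    refine Nat.add_lt_add_of_lt_of_le (card_lt_card ((ssubset_iff_of_subset (filter_subset _ _)).2
      ⟨#(upperNbrs G p K y), ?_, by simp⟩)) (card_le_card (filter_subset _ _))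
    exact mem_image_of_mem (fun y => #(upperNbrs G p K y)) hy
  · by_contra hne
    rcases lt_or_gt_of_ne (h.injective.ne hne) with hl | hl
    · exact (hφ x hx y hy hl).ne hxy
    · exact (hφ y hy x hx hl).ne hxy.symm

open Finset in
theorem IsUmbrellaOrder.card_upperNbrs_le [DecidableEq V] (h : IsUmbrellaOrder G p)
    (hG : TwinFree G) {𝒞 : Finset (Finset V)} (h𝒞 : IsCliqueCovering G 𝒞) (x : V) :
    #(upperNbrs G p ∅ x) ≤ 2 * ((valency 𝒞).centralBinom + 1) := by
  have hK : IsConvexClique G p (upperNbrs G p ∅ x) := by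
    refine ⟨fun y hy z hz hne => ?_, fun {u y z} hu hz huy hyz => ?_⟩
    · have hy := (mem_upperNbrs.1 (mem_coe.1 hy)).2
      have hz := (mem_upperNbrs.1 (mem_coe.1 hz)).2
      rcases lt_or_gt_of_ne (h.injective.ne hne) with hl | hl
      · exact (h.adj hy.2 hl hz.1).2
      · exact (h.adj hz.2 hl hy.1).2.symm
    · have hu := (mem_upperNbrs.1 hu).2
      have hz := (mem_upperNbrs.1 hz).2
      exact mem_upperNbrs.2 ⟨notMem_empty _, (h.adj (hu.2.trans huy) hyz hz.1).1, hu.2.trans huy⟩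
  have h₁ := hK.card_le h hG
  have h₂ := hK.card_image_upperNbrs_le h h𝒞
  have h₃ := hK.neg.card_image_upperNbrs_le h.neg h𝒞
  omega

open Finset in
/-- In a twin-free graph with an umbrella order, the degrees are bounded in terms of the valency
of a clique covering. -/
theorem IsUmbrellaOrder.degree_le [DecidableEq V] [DecidableRel G.Adj] (h : IsUmbrellaOrder G p)
    (hG : TwinFree G) {𝒞 : Finset (Finset V)} (h𝒞 : IsCliqueCovering G 𝒞) (x : V) :
    G.degree x ≤ 8 * (valency 𝒞).centralBinom := by
  have h₁ := h.card_upperNbrs_le hG h𝒞 x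
  have h₂ := h.neg.card_upperNbrs_le hG h𝒞 x
  have h₃ : G.degree x ≤ #(upperNbrs G p ∅ x ∪ upperNbrs G (fun x => - p x) ∅ x) := by
    refine card_le_card fun z hz => ?_
    have hA : G.Adj x z := by simpa using hz
    rcases lt_or_gt_of_ne (h.injective.ne hA.ne) with hl | hl <;>
      simp [mem_upperNbrs, hA, hl]
  have h₄ := h₃.trans (card_union_le _ _)
  have := (valency 𝒞).centralBinom_pos
  omega

end

end LocalCliqueCover

theorem mainTheorem4 :
    ∃ c : ℝ, ∀ (V : Type*) [Fintype V] [DecidableEq V] (G : SimpleGraph V) [DecidableRel G.Adj],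
      LocalCliqueCover.IsLinearInterval G → 2 ≤ G.maxDegree →
        (LocalCliqueCover.lcc G : ℝ) ≤
            Real.logb 2 G.maxDegree + 1 / 2 * Real.logb 2 (Real.logb 2 G.maxDegree) + c ∧
        (LocalCliqueCover.TwinFree G →
          1 / 2 * Real.logb 2 G.maxDegree + 1 / 4 * Real.logb 2 (Real.logb 2 G.maxDegree) - c ≤
            (LocalCliqueCover.lcc G : ℝ)) := by
  -- The upper bound needs 5: 2 from the estimate for `j` and 3 from `2 * (j + 1) + 1`. The lower
  -- bound needs only 5/2.
  refine ⟨5, fun V _ _ G _ hG hΔ => ?_⟩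
  obtain ⟨p, hp⟩ := hG.exists_isUmbrellaOrder
  constructor
  · have hex : ∃ k : ℕ, G.maxDegree < k.centralBinom :=
      ⟨_, LocalCliqueCover.self_lt_centralBinom _⟩
    obtain ⟨k, hspec, hmin⟩ : ∃ k : ℕ, G.maxDegree < k.centralBinom ∧
        ∀ m < k, ¬ G.maxDegree < m.centralBinom :=
      ⟨Nat.find hex, Nat.find_spec hex, fun _ => Nat.find_min hex⟩
    have hk : 2 ≤ k := by
      by_contra! hk
      interval_cases k
      · rw [Nat.centralBinom_zero] at hspec; omega
      · have : Nat.centralBinom 1 = 2 := rfl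
        omega
    obtain ⟨j, rfl⟩ : ∃ j, k = j + 1 := ⟨k - 1, by omega⟩
    have hj := LocalCliqueCover.two_mul_le_of_centralBinom_le (by omega) hΔ
      (not_lt.1 (hmin j (Nat.lt_succ_self j)))
    have hlcc := hp.lcc_le fun x => (G.degree_le_maxDegree x).trans_lt hspec
    have hlcc' : (LocalCliqueCover.lcc G : ℝ) ≤ 2 * (j + 1) + 1 := by exact_mod_cast hlcc
    linarith
  · intro htw
    obtain ⟨𝒞, h𝒞, hval⟩ := LocalCliqueCover.exists_covering_valency_eq_lcc G
    have hdeg : G.maxDegree ≤ 8 * (LocalCliqueCover.lcc G).centralBinom :=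
      hval ▸ G.maxDegree_le_of_forall_degree_le _ fun x => hp.degree_le htw h𝒞 x
    have hpos : 1 ≤ LocalCliqueCover.lcc G := by
      obtain ⟨x, hx⟩ : ∃ x, 0 < G.degree x := by
        by_contra! hx
        have := G.maxDegree_le_of_forall_degree_le 0 hx
        omega
      obtain ⟨y, hy⟩ := (G.degree_pos_iff_exists_adj x).1 hx
      obtain ⟨C, hC, hxC, -⟩ := h𝒞.covers x y hy
      rw [← hval]
      exact (Finset.card_pos.2 ⟨C, Finset.mem_filter.2 ⟨hC, hxC⟩⟩).trans_le
        (Finset.le_sup (f := LocalCliqueCover.vertexValency 𝒞) (Finset.mem_univ x))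
    have := LocalCliqueCover.le_two_mul_of_le_centralBinom hpos hΔ hdeg
    linarith
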